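/- Let $M$ be a finite set of items. A valuation is a function $v:2^M\to\mathbb{R}_{\ge 0}$ with $v(\emptyset)=0$ and $v(S)\le v(T)$ whenever $S\subseteq T\subseteq M$. A price vector is $\mathbf{p}\in\mathbb{R}_{\ge 0}^M$, and the demand correspondence of $v$ at $\mathbf{p}$ is $$D_{\mathbf{p}}(v)=\arg\max_{S\subseteq M}\Big(v(S)-\sum_{d\in S}p_d\Big).$$ The valuation $v$ is gross-substitutes if for all price vectors $\mathbf{p}\le\mathbf{q}$ (pointwise) and every $A\in D_{\mathbf{p}}(v)$ there is $B\in D_{\mathbf{q}}(v)$ with $A\cap\{x\in M\mid p_x=q_x\}\subseteq B$. Theorem. A valuation $v$ is gross-substitutes if and only if both of the following conditions hold: (NP-SM) There are no price vector $\mathbf{p}\in\mathbb{R}_{\ge 0}^M$, two different items $x,y\in M$ and bundle $S\subseteq M\setminus\{x,y\}$ such that $p_x,p_y>0$ and $$\{S,\;S\cup\{x,y\}\}\subseteq D_{\mathbf{p}}(v)\subseteq\{T\mid T\subseteq S\}\cup\{T\cup\{x,y\}\mid T\subseteq S\}.$$ (NP-RGP) There are no price vector $\mathbf{p}\in\mathbb{R}_{\ge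 0}^M$, three different items $x,y,z\in M$ and bundle $S\subseteq M\setminus\{x,y,z\}$ such that $p_x,p_y,p_z>0$ and $$\{S\cup\{x\},\;S\cup\{y,z\}\}\subseteq D_{\mathbf{p}}(v)\subseteq\{T\cup\{x\}\mid T\subseteq S\}\cup\{T\cup\{y,z\}\mid T\subseteq S\}.$$ -/

import Mathlib

namespace Market

variable {M : Type*}

/-- A (monotone, normalized) valuation on bundles of items, with nonnegative real values. -/
structure IsValuation (v : Finset M → ℝ) : Prop where
  nonneg : ∀ S, 0 ≤ v S
  mono : ∀ S T, S ⊆ T → v S ≤ v T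
  empty : v ∅ = 0

/-- A price vector assigns a nonnegative real price to every item. -/
def IsPriceVector (p : M → ℝ) : Prop := ∀ x, 0 ≤ p x

/-- The quasi-linear utility of the bundle `S` at prices `p`. -/
def utility (v : Finset M → ℝ) (p : M → ℝ) (S : Finset M) : ℝ := v S - ∑ x ∈ S, p x

/-- The demand correspondence: the collection of utility-maximizing bundles at prices `p`. -/
def demand (v : Finset M → ℝ) (p : M → ℝ) : Set (Finset M) :=
  {S | ∀ T, utility v p T ≤ utility v p S}

/-- Gross-substitutes: if prices weakly increase from `p` to `q`, then every bundle `A` demanded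
at `p` admits a bundle `B` demanded at `q` that still contains all items of `A` whose price
did not change. -/
def GrossSubstitutes (v : Finset M → ℝ) : Prop :=
  ∀ p q : M → ℝ, IsPriceVector p → IsPriceVector q → (∀ x, p x ≤ q x) →
    ∀ A ∈ demand v p, ∃ B ∈ demand v q, ∀ x ∈ A, p x = q x → x ∈ B

variable [DecidableEq M]

/-- The nonnegative-price version of the submodularity condition. -/
def NPSM (v : Finset M → ℝ) : Prop :=
  ¬ ∃ (p : M → ℝ) (x y : M) (S : Finset M),
    IsPriceVector p ∧ x ≠ y ∧ x ∉ S ∧ y ∉ S ∧ 0 < p x ∧ 0 < p y ∧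
    {S, S ∪ {x, y}} ⊆ demand v p ∧
    demand v p ⊆ {T | T ⊆ S} ∪ {R | ∃ T ⊆ S, R = T ∪ {x, y}}

/-- The nonnegative-price version of the triplet condition. -/
def NPRGP (v : Finset M → ℝ) : Prop :=
  ¬ ∃ (p : M → ℝ) (x y z : M) (S : Finset M),
    IsPriceVector p ∧ x ≠ y ∧ x ≠ z ∧ y ≠ z ∧ x ∉ S ∧ y ∉ S ∧ z ∉ S ∧
    0 < p x ∧ 0 < p y ∧ 0 < p z ∧
    {S ∪ {x}, S ∪ {y, z}} ⊆ demand v p ∧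
    demand v p ⊆ {R | ∃ T ⊆ S, R = T ∪ {x}} ∪ {R | ∃ T ⊆ S, R = T ∪ {y, z}}

end Market

namespace Market

open Finset

/-! ### From local exchange to global exchange -/

/-! Both price conditions encode local inequalities on `v`: `LocalSubmodular` and
`TripletCondition`. If one fails, focal prices realise exactly the forbidden demand set
(`localSubmodular_of_NPSM`, `tripletCondition_of_NPRGP`). Conversely, the local inequalities say
that `v`, padded with dummy items, satisfies the four-point inequality, which propagates to the
valuated-matroid exchange (`exists_exchange_of_four_point`). Removing the dummies gives the M♮
exchange `exists_exchange`, which handles one price increase at a time. That gross-substitutes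
excludes the forbidden demand sets is a one-price perturbation. -/

/-- A function on finite sets satisfying the four-point inequality satisfies the exchange
property of valuated matroids on sets of equal cardinality. -/
theorem exists_exchange_of_four_point {α : Type*} [DecidableEq α] (w : Finset α → ℝ)
    (h : ∀ (X : Finset α) (a b c d : α), a ≠ b → a ≠ c → a ≠ d → b ≠ c → b ≠ d → c ≠ d →
      a ∉ X → b ∉ X → c ∉ X → d ∉ X →
      w (insert a (insert b X)) + w (insert c (insert d X)) ≤
        max (w (insert a (insert c X)) + w (insert b (insert d X)))
          (w (insert a (insert d X)) + w (insert b (insert c X)))) :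
    ∀ (n : ℕ) (A B : Finset α), #(A \ B) = n → #(B \ A) = n → ∀ u ∈ A \ B, ∃ y ∈ B \ A,
      w A + w B ≤ w (insert y (A.erase u)) + w (insert u (B.erase y)) := by
  intro n
  induction n with
  | zero =>
    intro A B hA _ u hu
    rw [card_eq_zero] at hA
    simp [hA] at hu
  | succ n ih =>
    intro A B hA hB u hu
    have huA := (mem_sdiff.1 hu).1
    have huB := (mem_sdiff.1 hu).2
    rcases Nat.eq_zero_or_pos n with rfl | hn
    · obtain ⟨y, hy⟩ := card_eq_one.1 hB
      obtain ⟨u', hu'⟩ := card_eq_one.1 hA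
      obtain rfl : u = u' := by simpa [hu'] using hu
      have hyBA : y ∈ B \ A := by simp [hy]
      refine ⟨y, hyBA, ?_⟩
      have e1 : insert y (A.erase u) = B := by
        ext t
        have h1 := Finset.ext_iff.1 hy t
        have h2 := Finset.ext_iff.1 hu' t
        simp only [mem_sdiff, mem_singleton, mem_insert, mem_erase] at *
        grind
      have e2 : insert u (B.erase y) = A := by
        ext t
        have h1 := Finset.ext_iff.1 hy t
        have h2 := Finset.ext_iff.1 hu' t
        simp only [mem_sdiff, mem_singleton, mem_insert, mem_erase] at *
        grind
      rw [e1, e2, add_comm]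
    · obtain ⟨u₀, hu₀, hne⟩ := exists_mem_ne (by omega : 1 < #(A \ B)) u
      have hu₀A := (mem_sdiff.1 hu₀).1
      have hu₀B := (mem_sdiff.1 hu₀).2
      obtain ⟨y₀, hy₀, hmax⟩ := exists_max_image (B \ A)
        (fun y => w (insert u₀ (B.erase y)) + w (insert y (A.erase u)))
        (card_pos.1 (by omega))
      have hy₀B := (mem_sdiff.1 hy₀).1
      have hy₀A := (mem_sdiff.1 hy₀).2
      by_contra! hcon
      have d1 : A \ insert u₀ (B.erase y₀) = (A \ B).erase u₀ := by
        ext t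
        simp only [mem_sdiff, mem_insert, mem_erase]
        grind
      have d2 : insert u₀ (B.erase y₀) \ A = (B \ A).erase y₀ := by
        ext t
        simp only [mem_sdiff, mem_insert, mem_erase]
        grind
      -- `B - y₀ + u₀` is one step closer to `A`. Add its exchange to the four-point inequality for
      -- `u₀, u, y₀, y`: one branch contradicts failure at `y`, the other, by maximality of `y₀`,
      -- failure at `y₀`.
      obtain ⟨y, hy, hle⟩ := ih A (insert u₀ (B.erase y₀))
        (by rw [d1, card_erase_of_mem hu₀, hA]; rfl)
        (by rw [d2, card_erase_of_mem hy₀, hB]; rfl) u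
        (by rw [d1]; exact mem_erase.2 ⟨hne.symm, hu⟩)
      rw [d2, mem_erase] at hy
      obtain ⟨hyy₀, hyBA⟩ := hy
      have hyB := (mem_sdiff.1 hyBA).1
      have hyA := (mem_sdiff.1 hyBA).2
      have key := h ((B.erase y₀).erase y) u₀ u y₀ y hne (ne_of_mem_of_not_mem hu₀A hy₀A)
        (ne_of_mem_of_not_mem hu₀A hyA) (ne_of_mem_of_not_mem huA hy₀A)
        (ne_of_mem_of_not_mem huA hyA) hyy₀.symm (by simp [hu₀B]) (by simp [huB]) (by simp)
        (by simp)
      have hm := hmax y hyBA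
      have c1 := hcon y hyBA
      have c2 := hcon y₀ hy₀
      clear h ih hmax hcon hA hB d1 d2
      have e1 : insert u (Finset.erase (insert u₀ (B.erase y₀)) y) =
          insert u₀ (insert u ((B.erase y₀).erase y)) := by grind
      have e2 : insert y₀ (insert y ((B.erase y₀).erase y)) = B := by grind
      have e3 : insert u₀ (insert y₀ ((B.erase y₀).erase y)) = insert u₀ (B.erase y) := by grind
      have e4 : insert u (insert y ((B.erase y₀).erase y)) = insert u (B.erase y₀) := by grind
      have e5 : insert u₀ (insert y ((B.erase y₀).erase y)) = insert u₀ (B.erase y₀) := by grind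
      have e6 : insert u (insert y₀ ((B.erase y₀).erase y)) = insert u (B.erase y) := by grind
      rw [e2, e3, e4, e5, e6] at key
      rw [e1] at hle
      rcases le_max_iff.1 key with hk | hk <;> linarith

variable {M : Type*} [DecidableEq M]

/-- Decreasing marginal values, in local form. -/
def LocalSubmodular (v : Finset M → ℝ) : Prop :=
  ∀ (S : Finset M) (x y : M), x ≠ y → x ∉ S → y ∉ S →
    v S + v (insert x (insert y S)) ≤ v (insert x S) + v (insert y S)

/-- The triplet condition. -/
def TripletCondition (v : Finset M → ℝ) : Prop :=
  ∀ (S : Finset M) (x y z : M), x ≠ y → x ≠ z → y ≠ z → x ∉ S → y ∉ S → z ∉ S →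
    v (insert x S) + v (insert y (insert z S)) ≤
      max (v (insert y S) + v (insert x (insert z S)))
        (v (insert z S) + v (insert x (insert y S)))

/-- Each of the four triplets moves a singleton term between `{a, b}` and `{c, d}`. Following these
moves gives a cycle of length two or four; summed along it, the singletons cancel and `ab + cd`
cannot exceed both other pairings. -/
theorem TripletCondition.four_point {v : Finset M → ℝ} (h : TripletCondition v) (S : Finset M)
    (a b c d : M) (hab : a ≠ b) (hac : a ≠ c) (had : a ≠ d) (hbc : b ≠ c) (hbd : b ≠ d)
    (hcd : c ≠ d) (ha : a ∉ S) (hb : b ∉ S) (hc : c ∉ S) (hd : d ∉ S) :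
    v (insert a (insert b S)) + v (insert c (insert d S)) ≤
      max (v (insert a (insert c S)) + v (insert b (insert d S)))
        (v (insert a (insert d S)) + v (insert b (insert c S))) := by
  have h1 := h S c a b hac.symm hbc.symm hab hc ha hb
  have h2 := h S d a b had.symm hbd.symm hab hd ha hb
  have h3 := h S a c d hac had hcd ha hc hd
  have h4 := h S b c d hbc hbd hcd hb hc hd
  rw [insert_comm c b, insert_comm c a] at h1
  rw [insert_comm d b, insert_comm d a] at h2
  by_contra! hcon
  obtain ⟨c1, c2⟩ := max_lt_iff.1 hcon
  rcases le_max_iff.1 h1 with h1 | h1 <;> rcases le_max_iff.1 h2 with h2 | h2 <;>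
    rcases le_max_iff.1 h3 with h3 | h3 <;> rcases le_max_iff.1 h4 with h4 | h4 <;> linarith

/-- Adding dummy items turns the local conditions into the four-point inequality. -/
theorem four_point_toLeft {v : Finset M → ℝ} (hS : LocalSubmodular v) (hT : TripletCondition v)
    {β : Type*} [DecidableEq β] (X : Finset (M ⊕ β)) (a b c d : M ⊕ β) (hab : a ≠ b) (hac : a ≠ c)
    (had : a ≠ d) (hbc : b ≠ c) (hbd : b ≠ d) (hcd : c ≠ d) (ha : a ∉ X) (hb : b ∉ X)
    (hc : c ∉ X) (hd : d ∉ X) :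
    v (insert a (insert b X)).toLeft + v (insert c (insert d X)).toLeft ≤
      max (v (insert a (insert c X)).toLeft + v (insert b (insert d X)).toLeft)
        (v (insert a (insert d X)).toLeft + v (insert b (insert c X)).toLeft) := by
  have hL : ∀ x : M, Sum.inl x ∉ X → x ∉ X.toLeft := fun x hx => by simpa using hx
  have hinj : ∀ x y : M, (Sum.inl x : M ⊕ β) ≠ Sum.inl y → x ≠ y := fun x y hxy e => hxy (by rw [e])
  -- With one dummy this is the triplet condition; with two, submodularity if they are paired on the
  -- left, and otherwise an identity, as with three or four.
  rcases a with a | a <;> rcases b with b | b <;> rcases c with c | c <;> rcases d with d | d <;>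
    simp only [toLeft_insert_inl, toLeft_insert_inr]
  · exact hT.four_point _ a b c d (hinj _ _ hab) (hinj _ _ hac) (hinj _ _ had) (hinj _ _ hbc)
      (hinj _ _ hbd) (hinj _ _ hcd) (hL _ ha) (hL _ hb) (hL _ hc) (hL _ hd)
  · have := hT X.toLeft c a b (hinj _ _ hac).symm (hinj _ _ hbc).symm (hinj _ _ hab) (hL _ hc)
      (hL _ ha) (hL _ hb)
    rw [insert_comm c b, insert_comm c a] at this
    rcases le_max_iff.1 this with h | h
    · exact le_max_of_le_right (by linarith)
    · exact le_max_of_le_left (by linarith)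
  · have := hT X.toLeft d a b (hinj _ _ had).symm (hinj _ _ hbd).symm (hinj _ _ hab) (hL _ hd)
      (hL _ ha) (hL _ hb)
    rw [insert_comm d b, insert_comm d a] at this
    rcases le_max_iff.1 this with h | h
    · exact le_max_of_le_left (by linarith)
    · exact le_max_of_le_right (by linarith)
  · have := hS X.toLeft a b (hinj _ _ hab) (hL _ ha) (hL _ hb)
    exact le_max_of_le_left (by linarith)
  · have := hT X.toLeft a c d (hinj _ _ hac) (hinj _ _ had) (hinj _ _ hcd) (hL _ ha)
      (hL _ hc) (hL _ hd)
    rcases le_max_iff.1 this with h | h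
    · exact le_max_of_le_right (by linarith)
    · exact le_max_of_le_left (by linarith)
  · exact le_max_of_le_right (by linarith)
  · exact le_max_of_le_left (by linarith)
  · exact le_max_of_le_left (by linarith)
  · have := hT X.toLeft b c d (hinj _ _ hbc) (hinj _ _ hbd) (hinj _ _ hcd) (hL _ hb)
      (hL _ hc) (hL _ hd)
    rcases le_max_iff.1 this with h | h
    · exact le_max_of_le_left (by linarith)
    · exact le_max_of_le_right (by linarith)
  · exact le_max_of_le_left (by linarith)
  · exact le_max_of_le_right (by linarith)
  · exact le_max_of_le_left (by linarith)
  · have := hS X.toLeft c d (hinj _ _ hcd) (hL _ hc) (hL _ hd)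
    exact le_max_of_le_left (by linarith)
  · exact le_max_of_le_left (by linarith)
  · exact le_max_of_le_left (by linarith)
  · exact le_max_of_le_left (by linarith)

/-- The local conditions imply the exchange property characterizing M♮-concave set functions. -/
theorem exists_exchange [Fintype M] {v : Finset M → ℝ} (hS : LocalSubmodular v)
    (hT : TripletCondition v) {A B : Finset M} {j : M} (hA : j ∈ A) (hB : j ∉ B) :
    v A + v B ≤ v (A.erase j) + v (insert j B) ∨
      ∃ y ∈ B \ A, v A + v B ≤ v (insert y (A.erase j)) + v (insert j (B.erase y)) := by
  -- Pad each bundle with the dummies of its complement, so all sizes agree. Receiving a dummy means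
  -- moving `j` alone.
  have hcard : ∀ C : Finset M, #(C.disjSum Cᶜ) = Fintype.card M := fun C => by
    rw [card_disjSum, card_add_card_compl]
  have hAB : #(B.disjSum Bᶜ \ A.disjSum Aᶜ) = #(A.disjSum Aᶜ \ B.disjSum Bᶜ) :=
    card_sdiff_comm ((hcard B).trans (hcard A).symm)
  obtain ⟨y, hy, hle⟩ := exists_exchange_of_four_point (fun X : Finset (M ⊕ M) => v X.toLeft)
    (four_point_toLeft hS hT) _ (A.disjSum Aᶜ) (B.disjSum Bᶜ) rfl hAB (Sum.inl j)
    (by simp [hA, hB])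
  simp only [toLeft_disjSum] at hle
  rcases y with y | y
  · right
    refine ⟨y, by simpa using hy, hle.trans (le_of_eq ?_)⟩
    congr 2 <;> (ext t; simp)
  · left
    refine hle.trans (le_of_eq ?_)
    congr 2 <;> (ext t; simp)

/-! ### From exchange to gross substitutes -/

omit [DecidableEq M] in
theorem demand_nonempty [Fintype M] (v : Finset M → ℝ) (p : M → ℝ) : (demand v p).Nonempty := by
  obtain ⟨B, -, hB⟩ := exists_max_image (univ : Finset (Finset M)) (utility v p) univ_nonempty
  exact ⟨B, fun T => hB T (mem_univ T)⟩

theorem utility_add (v : Finset M → ℝ) {p q : M → ℝ} {j : M} (h : ∀ x, x ≠ j → p x = q x)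
    {S : Finset M} (hS : j ∈ S) : utility v q S = utility v p S - (q j - p j) := by
  have : ∑ x ∈ S.erase j, q x = ∑ x ∈ S.erase j, p x :=
    sum_congr rfl fun x hx => (h x (ne_of_mem_erase hx)).symm
  rw [utility, utility, ← add_sum_erase _ _ hS, ← add_sum_erase S p hS, this]
  ring

omit [DecidableEq M] in
theorem utility_eq_of_notMem (v : Finset M → ℝ) {p q : M → ℝ} {j : M}
    (h : ∀ x, x ≠ j → p x = q x) {S : Finset M} (hS : j ∉ S) : utility v q S = utility v p S := by
  rw [utility, utility, sum_congr rfl fun x hx => h x (ne_of_mem_of_not_mem hx hS)]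

omit [DecidableEq M] in
theorem utility_anti (v : Finset M → ℝ) {p q : M → ℝ} (h : ∀ x, p x ≤ q x) (S : Finset M) :
    utility v q S ≤ utility v p S :=
  sub_le_sub_left (sum_le_sum fun x _ => h x) _

/-- Under the local conditions, raising the price of a single item keeps all other items of a
demanded bundle in demand. -/
theorem exists_mem_demand_of_single_increase [Fintype M] {v : Finset M → ℝ}
    (hS : LocalSubmodular v) (hT : TripletCondition v) {p q : M → ℝ} {j : M}
    (h : ∀ x, x ≠ j → p x = q x) (hj : p j ≤ q j) {A : Finset M} (hA : A ∈ demand v p) :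
    ∃ B ∈ demand v q, A.erase j ⊆ B := by
  have hpq : ∀ x, p x ≤ q x := fun x => by
    by_cases hx : x = j
    · rwa [hx]
    · exact (h x hx).le
  by_cases hAq : A ∈ demand v q
  · exact ⟨A, hAq, erase_subset _ _⟩
  have hjA : j ∈ A := by
    by_contra hjA
    refine hAq fun T => ?_
    rw [utility_eq_of_notMem v h hjA]
    exact (utility_anti v hpq T).trans (hA T)
  -- All bundles containing `j` lose the same amount, so `A` stays best among them. In the exchange
  -- with `B`, the side receiving `j` is thus no better than `A`, so the other is no worse than `B`.
  have hle : ∀ T, j ∈ T → utility v q T ≤ utility v q A := fun T hT' => by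
    rw [utility_add v h hT', utility_add v h hjA]
    exact sub_le_sub_right (hA T) _
  obtain ⟨B, hB⟩ := demand_nonempty v q
  have hjB : j ∉ B := fun hjB => hAq fun T => (hB T).trans (hle B hjB)
  rcases exists_exchange hS hT hjA hjB with hex | ⟨y, hy, hex⟩
  · refine ⟨A.erase j, fun T => (hB T).trans ?_, subset_rfl⟩
    have h1 := hle (insert j B) (mem_insert_self _ _)
    have s1 := add_sum_erase A q hjA
    have s2 := sum_insert (f := q) hjB
    simp only [utility] at h1 ⊢
    linarith
  · obtain ⟨hyB, hyA⟩ := mem_sdiff.1 hy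
    refine ⟨insert y (A.erase j), fun T => (hB T).trans ?_, subset_insert _ _⟩
    have h1 := hle (insert j (B.erase y)) (mem_insert_self _ _)
    have s1 := add_sum_erase A q hjA
    have s2 := sum_insert (f := q) (fun hm => hjB (mem_of_mem_erase hm) : j ∉ B.erase y)
    have s3 := add_sum_erase B q hyB
    have s4 := sum_insert (f := q) (fun hm => hyA (mem_of_mem_erase hm) : y ∉ A.erase j)
    simp only [utility] at h1 ⊢
    linarith

/-- Prices are raised one item at a time; only an item whose price changes can be dropped. -/
theorem grossSubstitutes_of_local [Fintype M] {v : Finset M → ℝ} (hS : LocalSubmodular v)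
    (hT : TripletCondition v) : GrossSubstitutes v := by
  intro p q _ _ hpq A hA
  have key : ∀ T : Finset M, ∃ B ∈ demand v (fun x => if x ∈ T then q x else p x),
      ∀ x ∈ A, p x = q x → x ∈ B := by
    intro T
    induction T using Finset.induction_on with
    | empty => exact ⟨A, by simpa using hA, fun x hx _ => hx⟩
    | insert j T hj ih =>
      obtain ⟨B, hB, hAB⟩ := ih
      by_cases hpj : p j = q j
      · refine ⟨B, ?_, hAB⟩
        convert hB using 2
        ext x
        by_cases hx : x = j
        · subst hx
          simp [hj, hpj]
        · simp [hx]
      · obtain ⟨C, hC, hBC⟩ := exists_mem_demand_of_single_increase hS hT (j := j)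
          (q := fun x => if x ∈ insert j T then q x else p x)
          (fun x hx => by simp [hx]) (by simpa [hj] using hpq j) hB
        refine ⟨C, hC, fun x hx hpx => hBC (mem_erase.2 ⟨?_, hAB x hx hpx⟩)⟩
        rintro rfl
        exact hpj hpx
  simpa using key univ

/-! ### From the price conditions to the local conditions -/

/-- Prices that vanish on `S`, agree with `r` on `W`, and are prohibitive elsewhere. -/
def focusPrice [Fintype M] (v : Finset M → ℝ) (S W : Finset M) (r : M → ℝ) (d : M) : ℝ :=
  if d ∈ S then 0 else if d ∈ W then r d else v univ + 1

/-- At prices `focusPrice`, the demand is determined by the utilities of the bundles `S ∪ Q`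
with `Q ⊆ W`. -/
theorem mem_demand_focusPrice [Fintype M] {v : Finset M → ℝ} (hv : IsValuation v)
    {S W : Finset M} (hSW : Disjoint S W) {r : M → ℝ} (hr : ∀ x ∈ W, 0 ≤ r x) {u : ℝ} (hu : 0 ≤ u)
    (hmax : ∀ Q ⊆ W, v (S ∪ Q) - ∑ x ∈ Q, r x ≤ u) :
    IsPriceVector (focusPrice v S W r) ∧
    (∀ Q ⊆ W, v (S ∪ Q) - ∑ x ∈ Q, r x = u → S ∪ Q ∈ demand v (focusPrice v S W r)) ∧
    ((∃ Q ⊆ W, v (S ∪ Q) - ∑ x ∈ Q, r x = u) → ∀ R ∈ demand v (focusPrice v S W r),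
      ∃ T ⊆ S, ∃ Q ⊆ W, R = T ∪ Q ∧ v (S ∪ Q) - ∑ x ∈ Q, r x = u) := by
  set p := focusPrice v S W r with hp
  have hW : ∀ Q ⊆ W, ∑ x ∈ Q, p x = ∑ x ∈ Q, r x := fun Q hQ => sum_congr rfl fun x hx => by
    have h1 := hQ hx
    have h2 : x ∉ S := fun h => disjoint_left.1 hSW h h1
    simp [hp, focusPrice, h1, h2]
  have hp0 : IsPriceVector p := fun x => by
    have := hv.nonneg univ
    simp only [hp, focusPrice]
    split_ifs with h1 h2
    · exact le_rfl
    · exact hr x h2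
    · linarith
  have hutil : ∀ Q ⊆ W, utility v p (S ∪ Q) = v (S ∪ Q) - ∑ x ∈ Q, r x := fun Q hQ => by
    have h0 : ∑ x ∈ S, p x = 0 := sum_eq_zero fun x hx => by simp [hp, focusPrice, hx]
    rw [utility, sum_union (disjoint_of_subset_right hQ hSW), h0, hW Q hQ, zero_add]
  have hout : ∀ R, ¬ R ⊆ S ∪ W → utility v p R < u := fun R hR => by
    obtain ⟨x, hxR, hx⟩ := not_subset.1 hR
    have h1 : p x ≤ ∑ y ∈ R, p y := single_le_sum (fun y _ => hp0 y) hxR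
    have h2 : p x = v univ + 1 := by
      rw [mem_union, not_or] at hx
      simp [hp, focusPrice, hx.1, hx.2]
    have h3 := hv.mono R univ (subset_univ R)
    rw [utility]
    linarith
  -- Items of `S` are free, so adding all of them never hurts.
  have hin : ∀ R, R ⊆ S ∪ W → utility v p R ≤ v (S ∪ (R ∩ W)) - ∑ x ∈ R ∩ W, r x := fun R hR => by
    have h1 : v R ≤ v (S ∪ (R ∩ W)) := hv.mono _ _ fun x hx => by
      have := hR hx
      simp only [mem_union, mem_inter] at this ⊢
      tauto
    have h2 : ∑ x ∈ R ∩ W, p x ≤ ∑ x ∈ R, p x :=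
      sum_le_sum_of_subset_of_nonneg inter_subset_left fun x _ _ => hp0 x
    rw [hW _ inter_subset_right] at h2
    rw [utility]
    linarith
  have hall : ∀ R, utility v p R ≤ u := fun R => by
    by_cases hR : R ⊆ S ∪ W
    · exact (hin R hR).trans (hmax _ inter_subset_right)
    · exact (hout R hR).le
  refine ⟨hp0, fun Q hQ hQu T => ?_, ?_⟩
  · rw [hutil Q hQ, hQu]
    exact hall T
  · rintro ⟨Q, hQ, hQu⟩ R hR
    have hRu : u ≤ utility v p R := by
      rw [← hQu, ← hutil Q hQ]
      exact hR _
    have hsub : R ⊆ S ∪ W := by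
      by_contra hn
      exact absurd (hout R hn) (not_lt.2 hRu)
    exact ⟨R ∩ S, inter_subset_right, R ∩ W, inter_subset_right,
      by rw [← inter_union_distrib_left, inter_eq_left.2 hsub],
      le_antisymm (hmax _ inter_subset_right) (hRu.trans (hin R hsub))⟩

theorem eq_of_subset_pair {x y : M} {Q : Finset M} (h : Q ⊆ {x, y}) :
    Q = ∅ ∨ Q = {x} ∨ Q = {y} ∨ Q = {x, y} := by
  rw [← coe_subset, coe_pair, Set.subset_pair_iff_eq] at h
  exact_mod_cast h

theorem localSubmodular_of_NPSM [Fintype M] {v : Finset M → ℝ} (hv : IsValuation v)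
    (h : NPSM v) : LocalSubmodular v := by
  intro S x y hxy hx hy
  by_contra! hlt
  apply h
  have mx := hv.mono S (insert x S) (subset_insert _ _)
  have my := hv.mono S (insert y S) (subset_insert _ _)
  -- `ε` is half the violation: each single item falls short of `S` by `ε`, while the pair ties with
  -- `S`.
  obtain ⟨ε, hε, hεv⟩ : ∃ ε : ℝ, 0 < ε ∧
      v S + v (insert x (insert y S)) = v (insert x S) + v (insert y S) + 2 * ε :=
    ⟨(v S + v (insert x (insert y S)) - (v (insert x S) + v (insert y S))) / 2,
      by linarith, by ring⟩
  obtain ⟨r, hrx, hry⟩ : ∃ r : M → ℝ, r x = v (insert x S) - v S + ε ∧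
      r y = v (insert y S) - v S + ε :=
    ⟨fun d => if d = x then _ else _, if_pos rfl, if_neg hxy.symm⟩
  have hdisj : Disjoint S {x, y} := by simp [hx, hy]
  have hpair : v (S ∪ {x, y}) - ∑ d ∈ {x, y}, r d = v S := by
    rw [sum_pair hxy, hrx, hry, union_insert, union_singleton]
    linarith
  have hsx : v (S ∪ {x}) - ∑ d ∈ {x}, r d < v S := by
    rw [sum_singleton, hrx, union_singleton]
    linarith
  have hsy : v (S ∪ {y}) - ∑ d ∈ {y}, r d < v S := by
    rw [sum_singleton, hry, union_singleton]
    linarith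
  obtain ⟨hp, hmem, hdem⟩ := mem_demand_focusPrice hv hdisj (r := r) (u := v S)
    (by simp only [mem_insert, mem_singleton, forall_eq_or_imp, forall_eq]
        constructor <;> linarith) (hv.nonneg S)
    (fun Q hQ' => by
      rcases eq_of_subset_pair hQ' with rfl | rfl | rfl | rfl
      · simp
      · exact hsx.le
      · exact hsy.le
      · exact hpair.le)
  refine ⟨_, x, y, S, hp, hxy, hx, hy, ?_, ?_, ?_, ?_⟩
  · simp only [focusPrice, hx, mem_insert_self, if_true, if_false]
    linarith
  · simp only [focusPrice, hy, mem_insert, mem_singleton, or_true, if_true, if_false]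
    linarith
  · rintro R (rfl | rfl)
    · simpa using hmem ∅ (empty_subset _) (by simp)
    · exact hmem _ subset_rfl hpair
  · intro R hR
    obtain ⟨T, hT, Q, hQW, rfl, hQu⟩ := hdem ⟨_, subset_rfl, hpair⟩ R hR
    rcases eq_of_subset_pair hQW with rfl | rfl | rfl | rfl
    · exact Or.inl (by simpa using hT)
    · exact absurd hQu hsx.ne
    · exact absurd hQu hsy.ne
    · exact Or.inr ⟨T, hT, rfl⟩

theorem tripletCondition_of_NPRGP [Fintype M] {v : Finset M → ℝ} (hv : IsValuation v)
    (hS : LocalSubmodular v) (h : NPRGP v) : TripletCondition v := by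
  intro S x y z hxy hxz hyz hx hy hz
  by_contra! hlt
  obtain ⟨hlt1, hlt2⟩ := max_lt_iff.1 hlt
  apply h
  have m0 := hv.nonneg S
  have m1 := hv.mono (insert x S) (insert x (insert y S)) (by grind)
  have m2 := hv.mono (insert x S) (insert x (insert z S)) (by grind)
  have m3 := hv.mono (insert y (insert z S)) (insert x (insert y (insert z S))) (by grind)
  have s1 := hS S y z hyz hy hz
  have s2 := hS (insert x S) y z hyz (by simp [hxy.symm, hy]) (by simp [hxz.symm, hz])
  rw [insert_comm z x, insert_comm y x, insert_comm y x] at s2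
  -- The bounds on `a` and `b` make `y`, `z`, `xy`, `xz` suboptimal; `r x` forces `x` and `yz` to
  -- tie. Submodularity (`s1`, `s2`) rules out `∅` and `xyz`, and `s2` with `m3` makes `r x`
  -- positive.
  obtain ⟨a, ha1, ha2⟩ := exists_between
    (show v (insert x (insert y S)) - v (insert x S) <
      v (insert y (insert z S)) - v (insert z S) by linarith)
  obtain ⟨b, hb1, hb2⟩ := exists_between
    (show v (insert x (insert z S)) - v (insert x S) <
      v (insert y (insert z S)) - v (insert y S) by linarith)
  obtain ⟨r, hrx, hry, hrz⟩ : ∃ r : M → ℝ,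
      r x = v (insert x S) - v (insert y (insert z S)) + a + b ∧ r y = a ∧ r z = b :=
    ⟨fun d => if d = x then v (insert x S) - v (insert y (insert z S)) + a + b
      else if d = y then a else b, by simp, by simp [hxy.symm], by simp [hxz.symm, hyz.symm]⟩
  have hQ : ∀ Q ⊆ ({x, y, z} : Finset M), Q = ∅ ∨ Q = {x} ∨ Q = {y} ∨ Q = {z} ∨
      Q = {x, y} ∨ Q = {x, z} ∨ Q = {y, z} ∨ Q = {x, y, z} := fun Q hQ => by
    rw [subset_insert_iff] at hQ
    by_cases hxQ : x ∈ Q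
    · rw [← insert_erase hxQ]
      rcases eq_of_subset_pair hQ with h | h | h | h <;> simp [h]
    · rw [erase_eq_of_notMem hxQ] at hQ
      rcases eq_of_subset_pair hQ with h | h | h | h <;> simp [h]
  have hdisj : Disjoint S {x, y, z} := by simp [hx, hy, hz]
  obtain ⟨u, hu⟩ : ∃ u, u = v (insert y (insert z S)) - a - b := ⟨_, rfl⟩
  have h0 : v (S ∪ ∅) - ∑ d ∈ ∅, r d < u := by
    rw [sum_empty, union_empty]
    linarith
  have h1 : v (S ∪ {x}) - ∑ d ∈ {x}, r d = u := by
    rw [sum_singleton, hrx, union_singleton]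
    linarith
  have h2 : v (S ∪ {y}) - ∑ d ∈ {y}, r d < u := by
    rw [sum_singleton, hry, union_singleton]
    linarith
  have h3 : v (S ∪ {z}) - ∑ d ∈ {z}, r d < u := by
    rw [sum_singleton, hrz, union_singleton]
    linarith
  have h4 : v (S ∪ {x, y}) - ∑ d ∈ {x, y}, r d < u := by
    rw [sum_pair hxy, hrx, hry, union_insert, union_singleton]
    linarith
  have h5 : v (S ∪ {x, z}) - ∑ d ∈ {x, z}, r d < u := by
    rw [sum_pair hxz, hrx, hrz, union_insert, union_singleton]
    linarith
  have h6 : v (S ∪ {y, z}) - ∑ d ∈ {y, z}, r d = u := by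
    rw [sum_pair hyz, hry, hrz, union_insert, union_singleton]
    linarith
  have h7 : v (S ∪ {x, y, z}) - ∑ d ∈ {x, y, z}, r d < u := by
    rw [sum_insert (by simp [hxy, hxz]), sum_pair hyz, hrx, hry, hrz, union_insert, union_insert,
      union_singleton]
    linarith
  obtain ⟨hp, hmem, hdem⟩ := mem_demand_focusPrice hv hdisj (r := r) (u := u)
    (by simp only [mem_insert, mem_singleton, forall_eq_or_imp, forall_eq]
        refine ⟨?_, ?_, ?_⟩ <;> linarith) (by linarith)
    (fun Q hQ' => by
      rcases hQ Q hQ' with rfl | rfl | rfl | rfl | rfl | rfl | rfl | rfl <;>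
        first | exact le_of_eq ‹_› | exact le_of_lt ‹_›)
  refine ⟨_, x, y, z, S, hp, hxy, hxz, hyz, hx, hy, hz, ?_, ?_, ?_, ?_, ?_⟩
  · simp only [focusPrice, hx, mem_insert_self, if_true, if_false]
    linarith
  · simp only [focusPrice, hy, mem_insert, true_or, or_true, if_true, if_false]
    linarith
  · simp only [focusPrice, hz, mem_insert, mem_singleton, or_true, if_true, if_false]
    linarith
  · rintro R (rfl | rfl)
    · exact hmem _ (by simp) h1
    · exact hmem _ (subset_insert _ _) h6
  · intro R hR
    obtain ⟨T, hT, Q, hQW, rfl, hQu⟩ := hdem ⟨_, subset_insert _ _, h6⟩ R hR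
    rcases hQ Q hQW with rfl | rfl | rfl | rfl | rfl | rfl | rfl | rfl
    · exact absurd hQu h0.ne
    · exact Or.inl ⟨T, hT, rfl⟩
    · exact absurd hQu h2.ne
    · exact absurd hQu h3.ne
    · exact absurd hQu h4.ne
    · exact absurd hQu h5.ne
    · exact Or.inr ⟨T, hT, rfl⟩
    · exact absurd hQu h7.ne

/-! ### Gross substitutes satisfy the price conditions -/

/-- Suppose `C` and `A` are demanded and `C` avoids `y`. Raising the price of `y` shows that a
gross-substitutes valuation has a demanded bundle which avoids `y` and contains `A.erase y`. -/
theorem GrossSubstitutes.exists_mem_demand_notMem {v : Finset M → ℝ} (h : GrossSubstitutes v)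
    {p : M → ℝ} (hp : IsPriceVector p) {A C : Finset M} (hA : A ∈ demand v p)
    (hC : C ∈ demand v p) {y : M} (hy : y ∉ C) :
    ∃ B ∈ demand v p, y ∉ B ∧ A.erase y ⊆ B := by
  have hq : ∀ x, x ≠ y → p x = Function.update p y (p y + 1) x := fun x hx => by simp [hx]
  have hpq : ∀ x, p x ≤ Function.update p y (p y + 1) x := fun x => by
    by_cases hx : x = y
    · subst hx
      simp
    · exact (hq x hx).le
  obtain ⟨B, hB, hAB⟩ := h p _ hp (fun x => (hp x).trans (hpq x)) hpq A hA
  -- `C` keeps its utility, so the maximum is unchanged and any bundle with `y` falls below it.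
  have hCB := hB C
  rw [utility_eq_of_notMem v hq hy] at hCB
  refine ⟨B, fun T => (hC T).trans (hCB.trans (utility_anti v hpq B)), fun hyB => ?_,
    fun x hx => hAB x (mem_of_mem_erase hx) (hq x (ne_of_mem_erase hx))⟩
  rw [utility_add v hq hyB, Function.update_self] at hCB
  linarith [hC B]

theorem GrossSubstitutes.npsm {v : Finset M → ℝ} (h : GrossSubstitutes v) : NPSM v := by
  rintro ⟨p, x, y, S, hp, hxy, hx, hy, -, -, hsub, hdem⟩
  obtain ⟨B, hB, hyB, hAB⟩ := h.exists_mem_demand_notMem hp (hsub (Or.inr rfl))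
    (hsub (Or.inl rfl)) hy
  have hxB : x ∈ B := hAB (by simp [hxy])
  rcases hdem hB with hBS | ⟨T, -, rfl⟩
  · exact hx (hBS hxB)
  · exact hyB (by simp)

/-- Raising the price of `y` must leave a demanded bundle with `z` but not `y`, which neither
permitted form allows. -/
theorem GrossSubstitutes.nprgp {v : Finset M → ℝ} (h : GrossSubstitutes v) : NPRGP v := by
  rintro ⟨p, x, y, z, S, hp, hxy, hxz, hyz, hx, hy, hz, -, -, -, hsub, hdem⟩
  obtain ⟨B, hB, hyB, hAB⟩ := h.exists_mem_demand_notMem hp (hsub (Or.inr rfl))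
    (hsub (Or.inl rfl)) (y := y) (by simp [hy, hxy.symm])
  have hzB : z ∈ B := hAB (by simp [hyz.symm])
  rcases hdem hB with ⟨T, hT, rfl⟩ | ⟨T, -, rfl⟩
  · rcases mem_union.1 hzB with hzT | hzx
    · exact hz (hT hzT)
    · exact hxz (mem_singleton.1 hzx).symm
  · exact hyB (by simp)

end Market

theorem mainTheorem5 {M : Type*} [Fintype M] [DecidableEq M] (v : Finset M → ℝ)
    (hv : Market.IsValuation v) :
    Market.GrossSubstitutes v ↔ Market.NPSM v ∧ Market.NPRGP v := by
  refine ⟨fun h => ⟨h.npsm, h.nprgp⟩, fun ⟨h1, h2⟩ => ?_⟩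
  have hS := Market.localSubmodular_of_NPSM hv h1
  exact Market.grossSubstitutes_of_local hS (Market.tripletCondition_of_NPRGP hv hS h2)
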